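/- Let $K$ be a field, $X$ a finite set and $\Delta$ a simplicial complex on $X$, that is, a family of subsets of $X$ (faces) closed under taking subsets and containing $\emptyset$; let $d=\dim\Delta=\max\{|F|-1 : F\in\Delta\}$, and call $\Delta$ pure if all its facets (inclusion-maximal faces) have the same cardinality. The facet ideal of $\Delta$ is $I(\Delta)=(\prod_{x\in F}x : F \text{ a facet of } \Delta)\subseteq K[X]$. A monomial ideal has linear quotients if its minimal monomial generators can be ordered $f_1,\dots,f_m$ so that for every $2\le i\le m$ the colon ideal $(f_1,\dots,f_{i-1}):(f_i)$ is generated by a set of variables. Let $s\ge 1$ be an integer, $\alpha=(s,\dots,s)$, and let $X^\alpha=\{x_{t} : x\in X,\ 1\le t\le s\}$ consist of $s$ copies of each vertex. The expansion $\Delta^\alpha$ is the simplicial complex on $X^\alpha$ whose faces are all subsets of the sets $\{x_{j(x)} : x\in F\}$, where $F\in\Delta$ and $j:F\to\{1,\dots,s\}$. Let $\operatorname{pd}$ denote the projective dimension of an ideal as a module over its polynomial ring ($K[X]$ for $I(\Delta)$, $K[X^\alpha]$ for $I(\Delta^\alpha)$). If $I(\Delta)$ has linear quotients, then $\operatorname{pd}(I(\Delta))$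 and $\operatorname{pd}(I(\Delta^\alpha))$ are finite and $$\operatorname{pd}(I(\Delta^\alpha))\le s\cdot\operatorname{pd}(I(\Delta))+(d+1)(s-1).$$ If moreover $\Delta$ is pure, then $$\operatorname{pd}(I(\Delta^\alpha))= s\cdot\operatorname{pd}(I(\Delta))+(d+1)(s-1).$$ -/

import Mathlib

/-- A simplicial complex on the vertex set `V`: a set of finite subsets of `V` that is closed
under taking subsets and contains `∅`. As usual in combinatorial commutative algebra the empty
set counts as a face (so the complex `{∅}` of dimension `-1` is allowed), and a point of `V` need
not be a face. (Mathlib's `PreAbstractSimplicialComplex` excludes the empty face.) -/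
structure FaceComplex (V : Type*) where
  faces : Set (Finset V)
  empty_mem : ∅ ∈ faces
  down_closed : ∀ ⦃F G : Finset V⦄, F ∈ faces → G ⊆ F → G ∈ faces

namespace FaceComplex

/-- The facets, i.e. the faces that are maximal under inclusion. -/
def facets {V : Type*} (Δ : FaceComplex V) : Set (Finset V) :=
  {F | Maximal (· ∈ Δ.faces) F}

/-- `dim Δ = max {|F| - 1 : F ∈ Δ}`; used for finite `V` only, where the supremum is a maximum. -/
noncomputable def dim {V : Type*} (Δ : FaceComplex V) : ℤ :=
  ((sSup (Finset.card '' Δ.faces) : ℕ) : ℤ) - 1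

/-- `Δ` is pure if all its facets have the same dimension. -/
def IsPure {V : Type*} (Δ : FaceComplex V) : Prop :=
  ∀ F ∈ Δ.facets, ∀ G ∈ Δ.facets, F.card = G.card

/-- The set `{x_{i, j(i)} : i ∈ F}` in the expanded vertex set, whose points `⟨i, t⟩` are the
copies `x_{i,t}` of the vertex `i`, with `t` running through a set of `α i` elements. -/
def transversal {V : Type*} (α : V → ℕ) (F : Finset V) (j : (i : F) → Fin (α i)) :
    Finset (Σ i : V, Fin (α i)) :=
  (Finset.univ : Finset F).map
    ⟨fun i => ⟨i.1, j i⟩, fun _ _ h => Subtype.ext (congrArg Sigma.fst h)⟩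

/-- The expansion `Δ^α`, the union over all `F ∈ Δ` of the complexes `⟨F⟩^α` that are generated
by the sets `{x_{i, j(i)} : i ∈ F}`. -/
def expansion {V : Type*} (Δ : FaceComplex V) (α : V → ℕ) :
    FaceComplex (Σ i : V, Fin (α i)) where
  faces := {G | ∃ F ∈ Δ.faces, ∃ j : (i : F) → Fin (α i), G ⊆ transversal α F j}
  empty_mem := ⟨∅, Δ.empty_mem, fun i => absurd i.2 (Finset.notMem_empty _),
    Finset.empty_subset _⟩
  down_closed := fun _ _ ⟨F, hF, j, hj⟩ h => ⟨F, hF, j, h.trans hj⟩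

/-- The facet ideal `I(Δ) = (x^F : F a facet of Δ)` in `K[V]`, where `x^F = ∏_{i ∈ F} x_i`. -/
noncomputable def facetIdeal {V : Type*} (K : Type*) [Field K] (Δ : FaceComplex V) :
    Ideal (MvPolynomial V K) :=
  Ideal.span ((fun F : Finset V => ∏ i ∈ F, (MvPolynomial.X i : MvPolynomial V K)) '' Δ.facets)

end FaceComplex

namespace MonomialIdeal

/-- The exponent vectors of the minimal monomial generators of a monomial ideal `I`: the
monomials in `I` that are minimal under divisibility. -/
def minGens {V K : Type*} [Field K] (I : Ideal (MvPolynomial V K)) : Set (V →₀ ℕ) :=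
  {e | Minimal (fun e' => MvPolynomial.monomial e' (1 : K) ∈ I) e}

/-- A monomial ideal `I` has linear quotients if its minimal monomial generators can be ordered
as `f_1, …, f_m` such that each colon ideal `(f_1, …, f_{i-1}) : (f_i)` is generated by a set of
variables (for `i = 1` this holds trivially, with the empty set). -/
def HasLinearQuotients {V K : Type*} [Field K] (I : Ideal (MvPolynomial V K)) : Prop :=
  ∃ (m : ℕ) (f : Fin m → (V →₀ ℕ)), Function.Injective f ∧ Set.range f = minGens I ∧
    ∀ i : Fin m, ∃ A : Set V,
      (Ideal.span ((fun j => MvPolynomial.monomial (f j) (1 : K)) '' {j | j < i})).colon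
          (Ideal.span {MvPolynomial.monomial (f i) (1 : K)} : Ideal (MvPolynomial V K)) =
        Ideal.span ((MvPolynomial.X : V → MvPolynomial V K) '' A)

/-- The projective dimension of the ideal `I` as a module over the polynomial ring. -/
noncomputable def pd {V K : Type*} [Field K] (I : Ideal (MvPolynomial V K)) : WithBot ℕ∞ :=
  CategoryTheory.projectiveDimension (ModuleCat.of (MvPolynomial V K) I)

end MonomialIdeal

/-!
Suppose that the colon ideal of the `i`-th generator `x^{F i}` is generated by the variables in
`A i`. Adding the generators one at a time, the short exact sequences
`0 → (J : u) → J × R → J + (u) → 0` bound the projective dimension by `max |A i|`. This value is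
attained: filling the boundary of the simplex on `A i` in two ways, once by the simplex itself and
once inside a shellable complex coming from the earlier generators, gives a Koszul cycle in degree
`|A i|` with coefficient `x^{F i}` at `A i`. This coefficient does not lie in `𝔪 I`, so the cycle
is not a boundary, whereas Koszul homology vanishes in degrees beyond the projective dimension.

The facets of `Δ^α` are the transversals of the facets of `Δ`. Ordered first by the underlying
facet and then lexicographically by the chosen copies, they have linear quotients again: the colon
ideal of the transversal `j` of `F i` is generated by all copies of the vertices in `A i`, together
with the copies of each vertex of `F i` preceding the one chosen by `j`. The number of these
variables is largest for the last transversal, where it is `s |A i| + (s - 1) |F i|`.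
-/

open CategoryTheory MvPolynomial

open scoped Finset

namespace MonomialIdeal

section ProjectiveDimension

variable {R : Type*} [CommRing R] (J : Ideal R) (u : R)

/-- The map `J × R → J + (u)`, `(p, q) ↦ p + q u`, whose kernel is a copy of the colon ideal. -/
def adjoinGenerator : (J × R) →ₗ[R] ↥(J ⊔ Ideal.span {u}) :=
  (Submodule.inclusion le_sup_left).coprod (LinearMap.toSpanSingleton R _
    ⟨u, Ideal.mem_sup_right (Ideal.mem_span_singleton_self u)⟩)

theorem coe_adjoinGenerator (p : J × R) : (adjoinGenerator J u p : R) = p.1 + p.2 * u := rfl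

theorem adjoinGenerator_surjective : Function.Surjective (adjoinGenerator J u) := by
  rintro ⟨y, hy⟩
  obtain ⟨p, hp, q, hq, rfl⟩ := Submodule.mem_sup.1 hy
  obtain ⟨a, rfl⟩ := Ideal.mem_span_singleton'.1 hq
  exact ⟨(⟨p, hp⟩, a), rfl⟩

theorem mem_ker_adjoinGenerator {p : J × R} :
    p ∈ LinearMap.ker (adjoinGenerator J u) ↔ (p.1 : R) = -(p.2 * u) := by
  rw [LinearMap.mem_ker, ← Subtype.val_inj, coe_adjoinGenerator, ZeroMemClass.coe_zero,
    eq_neg_iff_add_eq_zero]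

/-- The kernel of `J × R → J + (u)` is the colon ideal `J : u`. -/
def kerAdjoinGeneratorEquiv :
    J.colon {u} ≃ₗ[R] LinearMap.ker (adjoinGenerator J u) where
  toFun q := ⟨(⟨-(q * u), neg_mem (Submodule.mem_colon_singleton.1 q.2)⟩, q),
    (mem_ker_adjoinGenerator J u).2 rfl⟩
  map_add' p q := by ext <;> simp; ring
  map_smul' a p := by ext <;> simp; ring
  invFun p := ⟨p.1.2, Submodule.mem_colon_singleton.2 <| by
    rw [smul_eq_mul, ← neg_neg (p.1.2 * u), ← (mem_ker_adjoinGenerator J u).1 p.2]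
    exact neg_mem p.1.1.2⟩
  left_inv _ := rfl
  right_inv p := Subtype.ext <| Prod.ext
    (Subtype.ext ((mem_ker_adjoinGenerator J u).1 p.2).symm) rfl

variable {J u} in
theorem hasProjectiveDimensionLT_sup_span {n : ℕ}
    (hcolon : HasProjectiveDimensionLT (ModuleCat.of R (J.colon {u})) n)
    (hJ : HasProjectiveDimensionLT (ModuleCat.of R J) (n + 1)) :
    HasProjectiveDimensionLT (ModuleCat.of R ↥(J ⊔ Ideal.span {u})) (n + 1) := by
  refine (LinearMap.shortExact_shortComplexKer (adjoinGenerator_surjective J u))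
    |>.hasProjectiveDimensionLT_X₃ n ?_ ?_
  · exact hasProjectiveDimensionLT_of_iso (kerAdjoinGeneratorEquiv J u).toModuleIso n
  · have : Projective (ModuleCat.of R R) := inferInstance
    exact hasProjectiveDimensionLT_of_iso (ModuleCat.biprodIsoProd (.of R J) (.of R R)) _

theorem colon_span_X_image {V : Type*} {A : Set V} {a : V} (ha : a ∉ A) :
    (Ideal.span ((X : V → MvPolynomial V R) '' A)).colon {X a} = Ideal.span (X '' A) := by
  ext q
  rw [Submodule.mem_colon_singleton, smul_eq_mul]
  refine ⟨fun h => ?_, Ideal.mul_mem_right _ _⟩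
  rw [mem_ideal_span_X_image] at h ⊢
  intro m hm
  obtain ⟨i, hi, him⟩ := h (m + Finsupp.single a 1) (by
    rwa [mem_support_iff, coeff_mul_X, ← mem_support_iff])
  have hai : a ≠ i := fun h => ha (h ▸ hi)
  exact ⟨i, hi, by simpa [hai] using him⟩

theorem hasProjectiveDimensionLT_span_X {V : Type*} (A : Finset V) :
    HasProjectiveDimensionLT (ModuleCat.of (MvPolynomial V R)
      (Ideal.span ((X : V → MvPolynomial V R) '' A))) #A := by
  classical
  induction A using Finset.induction_on with
  | empty =>
    rw [Finset.coe_empty, Set.image_empty, Ideal.span_empty]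
    exact (ModuleCat.isZero_of_subsingleton _).hasProjectiveDimensionLT_zero
  | insert a A ha ih =>
    rw [Finset.coe_insert, Set.image_insert_eq, Ideal.span_insert, sup_comm,
      Finset.card_insert_of_notMem ha]
    refine hasProjectiveDimensionLT_sup_span ?_ (hasProjectiveDimensionLT_of_ge _ _ _ (#A).le_succ)
    rwa [colon_span_X_image (Finset.mem_coe.not.2 ha)]

end ProjectiveDimension

end MonomialIdeal

namespace Koszul

section Division

variable {V R M : Type*} [CommRing R] [AddCommGroup M] [Module R M]

/-- Operators `T v` on `M` that undo multiplication by `x v` and commute with multiplication by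
the other `x w`. They exist, for instance, when the `x v` are the variables of a polynomial ring
and `M` is free. -/
structure IsDivisionFamily (x : V → R) (T : V → M →+ M) : Prop where
  apply_smul_self : ∀ v m, T v (x v • m) = m
  apply_smul_of_ne : ∀ {v w}, w ≠ v → ∀ m, T v (x w • m) = x w • T v m

theorem isDivisionFamily_one : IsDivisionFamily (1 : V → ℤ) fun _ => AddMonoidHom.id M where
  apply_smul_self _ m := one_smul ℤ m
  apply_smul_of_ne _ _ := rfl

theorem IsDivisionFamily.finsupp {x : V → R} {T : V → R →+ R} (hT : IsDivisionFamily x T)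
    (ι : Type*) :
    IsDivisionFamily x fun v => Finsupp.mapRange.addMonoidHom (ι := ι) (T v) where
  apply_smul_self v m := Finsupp.ext fun i => hT.apply_smul_self v (m i)
  apply_smul_of_ne h m := Finsupp.ext fun i => hT.apply_smul_of_ne h (m i)

theorem X_mul_divMonomial_of_ne {v w : V} (h : w ≠ v) (p : MvPolynomial V R) :
    (X w * p).divMonomial (Finsupp.single v 1) = X w * p.divMonomial (Finsupp.single v 1) := by
  ext m
  classical
  have mem_support : w ∈ (Finsupp.single v 1 + m).support ↔ w ∈ m.support := by
    simp [h.symm]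
  rw [coeff_divMonomial, coeff_X_mul', coeff_X_mul', coeff_divMonomial]
  simp only [mem_support]
  split_ifs with hw
  · rw [add_tsub_assoc_of_le]
    exact Finsupp.single_le_iff.2 (Nat.one_le_iff_ne_zero.2 (Finsupp.mem_support_iff.1 hw))
  · rfl

theorem isDivisionFamily_X :
    IsDivisionFamily (M := MvPolynomial V R) (X : V → MvPolynomial V R) fun v =>
      AddMonoidHom.mk' (fun p => p.divMonomial (Finsupp.single v 1))
        fun p q => add_divMonomial p q _ where
  apply_smul_self v p := X_mul_divMonomial v p
  apply_smul_of_ne h p := X_mul_divMonomial_of_ne h p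

end Division

section Differential

variable {V : Type*} [LinearOrder V]

/-- The sign of moving `v` to its place in the increasing enumeration of `insert v S`. -/
def sgn (v : V) (S : Finset V) : ℤ := (-1) ^ #{w ∈ S | w < v}

theorem sgn_mul_self (v : V) (S : Finset V) : sgn v S * sgn v S = 1 := by
  rw [sgn, ← mul_pow, neg_one_mul, neg_neg, one_pow]

theorem sgn_insert {v w : V} {S : Finset V} (hv : v ∉ S) :
    sgn w (insert v S) = if v < w then -sgn w S else sgn w S := by
  unfold sgn
  rw [Finset.filter_insert]
  split_ifs with h
  · rw [Finset.card_insert_of_notMem (by simp [hv]), pow_succ, mul_neg_one]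
  · rfl

theorem sgn_erase (v : V) (S : Finset V) : sgn v (S.erase v) = sgn v S := by
  rw [sgn, sgn, Finset.filter_erase, Finset.erase_eq_of_notMem (by simp)]

theorem sgn_mul_sgn_insert {v w : V} (h : v ≠ w) {S : Finset V} (hv : v ∉ S) (hw : w ∉ S) :
    sgn v S * sgn w (insert v S) = -(sgn w S * sgn v (insert w S)) := by
  rw [sgn_insert hv, sgn_insert hw]
  rcases h.lt_or_gt with h | h <;> simp [h, h.not_gt, mul_comm]

variable {M N : Type*} [AddCommGroup M] [AddCommGroup N]

/-- Contraction of the element `∑ f S e_S` of the exterior algebra by the dual of `e_v`. -/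
def contract (v : V) : (Finset V → M) →+ (Finset V → M) where
  toFun f S := if v ∈ S then 0 else sgn v S • f (insert v S)
  map_zero' := by ext; simp
  map_add' f g := by ext S; by_cases h : v ∈ S <;> simp [h]

/-- Left multiplication of `∑ f S e_S` by `e_v` in the exterior algebra. -/
def wedge (v : V) : (Finset V → M) →+ (Finset V → M) where
  toFun f S := if v ∈ S then sgn v S • f (S.erase v) else 0
  map_zero' := by ext; simp
  map_add' f g := by ext S; by_cases h : v ∈ S <;> simp [h]

theorem contract_apply (v : V) (f : Finset V → M) (S : Finset V) :
    contract v f S = if v ∈ S then 0 else sgn v S • f (insert v S) := rfl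

theorem wedge_apply (v : V) (f : Finset V → M) (S : Finset V) :
    wedge v f S = if v ∈ S then sgn v S • f (S.erase v) else 0 := rfl

theorem contract_comp (φ : M →+ N) (v : V) (f : Finset V → M) :
    contract v (φ ∘ f) = φ ∘ contract v f := by
  ext S; by_cases h : v ∈ S <;> simp [contract_apply, h]

theorem contract_contract_self (v : V) (f : Finset V → M) : contract v (contract v f) = 0 := by
  ext S; simp [contract_apply]

theorem contract_contract {v w : V} (h : v ≠ w) (f : Finset V → M) :
    contract v (contract w f) = -contract w (contract v f) := by
  ext S
  by_cases hv : v ∈ S <;> by_cases hw : w ∈ S <;>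
    simp only [contract_apply, hv, hw, h, h.symm, Finset.mem_insert, or_self, or_true, if_true,
      if_false, smul_zero, neg_zero, Pi.neg_apply, smul_smul]
  rw [sgn_mul_sgn_insert h hv hw, neg_smul, Finset.insert_comm]

theorem contract_wedge_of_ne {v w : V} (h : w ≠ v) (f : Finset V → M) :
    contract w (wedge v f) = -wedge v (contract w f) := by
  ext S
  by_cases hv : v ∈ S <;> by_cases hw : w ∈ S <;>
    simp only [contract_apply, wedge_apply, hv, hw, h, h.symm, Finset.mem_insert, Finset.mem_erase,
      or_false, or_true, and_true, and_false, ne_eq, not_false_eq_true, if_true, if_false,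
      smul_zero, neg_zero, Pi.neg_apply, smul_smul]
  obtain ⟨T, hT, rfl⟩ : ∃ T, v ∉ T ∧ insert v T = S :=
    ⟨S.erase v, Finset.notMem_erase v S, Finset.insert_erase hv⟩
  have hwT : w ∉ T := fun h' => hw (Finset.mem_insert_of_mem h')
  rw [← sgn_erase v, ← sgn_erase v (insert v T), Finset.erase_insert_of_ne h,
    Finset.erase_insert hT, mul_comm, ← neg_smul, sgn_insert hT, sgn_insert hwT]
  rcases h.lt_or_gt with h | h <;> simp [h, h.not_gt, mul_comm]

theorem contract_wedge_self_apply (v : V) (f : Finset V → M) (S : Finset V) :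
    contract v (wedge v f) S = if v ∈ S then 0 else f S := by
  rw [contract_apply, wedge_apply, if_pos (Finset.mem_insert_self v S)]
  split_ifs with hv
  · rfl
  · rw [← sgn_erase v (insert v S), Finset.erase_insert hv, smul_smul, sgn_mul_self, one_smul]

theorem wedge_contract_self_apply (v : V) (f : Finset V → M) (S : Finset V) :
    wedge v (contract v f) S = if v ∈ S then f S else 0 := by
  rw [wedge_apply, contract_apply, if_neg (Finset.notMem_erase v S)]
  split_ifs with hv
  · rw [sgn_erase, Finset.insert_erase hv, smul_smul, sgn_mul_self, one_smul]
  · rfl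

variable {R : Type*} [CommRing R] [Module R M] [Module R N]

theorem contract_smul (v : V) (a : R) (f : Finset V → M) :
    contract v (a • f) = a • contract v f :=
  contract_comp (DistribSMul.toAddMonoidHom M a) v f

variable [Fintype V]

/-- The differential of the Koszul complex of the family `x` with coefficients in `M`. The
underlying module consists of all families `f`, thought of as `∑ f S e_S`, indexed by the subsets
`S` of `V`. -/
def differential (x : V → R) : (Finset V → M) →+ (Finset V → M) :=
  ∑ v, (DistribSMul.toAddMonoidHom _ (x v)).comp (contract v)

theorem differential_eq_sum (x : V → R) (f : Finset V → M) :
    differential x f = ∑ v, x v • contract v f := by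
  simp [differential]

theorem differential_apply (x : V → R) (f : Finset V → M) (S : Finset V) :
    differential x f S = ∑ v, x v • contract v f S := by
  simp [differential_eq_sum]

theorem differential_comp (x : V → R) (φ : M →ₗ[R] N) (f : Finset V → M) :
    differential x (φ ∘ f) = φ ∘ differential x f := by
  ext S
  simp only [differential_apply, Function.comp_apply, map_sum, map_smul,
    show contract _ (φ ∘ f) = φ ∘ contract _ f from contract_comp φ.toAddMonoidHom _ f]

theorem differential_differential (x : V → R) (f : Finset V → M) :
    differential x (differential x f) = 0 := by
  simp only [differential_eq_sum, map_sum, contract_smul, smul_smul]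
  rw [← Finset.sum_product']
  refine Finset.sum_involution (fun p _ => p.swap) ?_ ?_ (by simp) (by simp)
  · rintro ⟨v, w⟩ -
    obtain rfl | h := eq_or_ne v w
    · simp [contract_contract_self]
    · simp [contract_contract h, mul_comm (x w)]
  · rintro ⟨v, w⟩ - h0 h
    obtain rfl : w = v := congrArg Prod.fst h
    simp [contract_contract_self] at h0

namespace IsDivisionFamily

variable {x : V → R} {T : V → M →+ M} (hT : IsDivisionFamily x T)
include hT

/-- The operator `T v ∘ e_v` is a contracting homotopy, up to terms not containing `e_v`. -/
theorem differential_wedge (v : V) (z : Finset V → M) (S : Finset V) :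
    differential x (T v ∘ wedge v z) S + T v (wedge v (differential x z) S) =
      if v ∈ S then z S else x v • T v (z S) := by
  have wedge_differential :
      wedge v (differential x z) S = ∑ w, x w • wedge v (contract w z) S := by
    by_cases hv : v ∈ S
    · simp only [wedge_apply, hv, if_true, differential_apply, Finset.smul_sum]
      exact Finset.sum_congr rfl fun w _ => smul_comm _ _ _
    · simp [wedge_apply, hv]
  rw [wedge_differential, differential_apply, map_sum, ← Finset.sum_add_distrib,
    Finset.sum_eq_single v]
  · rw [hT.apply_smul_self, contract_comp, Function.comp_apply, contract_wedge_self_apply,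
      wedge_contract_self_apply]
    split_ifs <;> simp
  · intro w _ hw
    rw [hT.apply_smul_of_ne hw, contract_comp, contract_wedge_of_ne hw]
    simp
  · simp

theorem exists_differential_eq {z : Finset V → M} {n : ℕ}
    (hz : ∀ S, n ≤ #S → differential x z S = 0) :
    ∃ y, ∀ S, n < #S → differential x y S = z S := by
  suffices h : ∀ B : Finset V, ∃ y, ∀ S, n < #S → (∃ b ∈ B, b ∈ S) →
      (z - differential x y : Finset V → M) S = 0 by
    obtain ⟨y, hy⟩ := h Finset.univ
    refine ⟨y, fun S hS => (sub_eq_zero.1 (hy S hS ?_)).symm⟩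
    obtain ⟨b, hb⟩ := Finset.card_pos.1 (n.zero_le.trans_lt hS)
    exact ⟨b, Finset.mem_univ b, hb⟩
  intro B
  induction B using Finset.induction_on with
  | empty => exact ⟨0, by simp⟩
  | insert v B _ ih =>
    obtain ⟨y, hy⟩ := ih
    set r := z - differential x y with hr
    refine ⟨y + T v ∘ wedge v r, fun S hS hBS => ?_⟩
    have wedge_differential : wedge v (differential x r) S = 0 := by
      rw [wedge_apply, hr, map_sub, differential_differential, sub_zero]
      split_ifs with hv
      · rw [hz _ (by rw [Finset.card_erase_of_mem hv]; omega), smul_zero]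
      · rfl
    have homotopy := hT.differential_wedge v r S
    rw [wedge_differential, map_zero, add_zero] at homotopy
    rw [map_add, ← sub_sub, ← hr, Pi.sub_apply, homotopy]
    split_ifs with hv
    · exact sub_self _
    · rw [hy S hS (by simpa [hv] using hBS), map_zero, smul_zero, sub_zero]

end IsDivisionFamily

end Differential

section ProjectiveDimension

universe u

variable {V : Type*} [LinearOrder V] [Fintype V] {R : Type u} [CommRing R] {x : V → R}
  {T : V → R →+ R}

theorem IsDivisionFamily.exists_differential_eq_of_retract (hT : IsDivisionFamily x T)
    {M : Type*} [AddCommGroup M] [Module R M] {ι : Type*} (p : (ι →₀ R) →ₗ[R] M)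
    (s : M →ₗ[R] (ι →₀ R)) (hs : p ∘ₗ s = LinearMap.id) {n : ℕ} {z : Finset V → M}
    (hz : ∀ S, n ≤ #S → differential x z S = 0) :
    ∃ y, ∀ S, n < #S → differential x y S = z S := by
  obtain ⟨y, hy⟩ := (hT.finsupp ι).exists_differential_eq (z := s ∘ z) (n := n) fun S hS => by
    rw [differential_comp, Function.comp_apply, hz S hS, map_zero]
  refine ⟨p ∘ y, fun S hS => ?_⟩
  rw [differential_comp, Function.comp_apply, hy S hS]
  exact LinearMap.congr_fun hs (z S)

theorem IsDivisionFamily.exists_differential_eq_of_ker (hT : IsDivisionFamily x T)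
    {M : Type*} [AddCommGroup M] [Module R M] {ι : Type*} {p : (ι →₀ R) →ₗ[R] M}
    (hp : Function.Surjective p) {n : ℕ}
    (hker : ∀ c : Finset V → LinearMap.ker p, differential x c = 0 →
      ∃ w, ∀ S, n ≤ #S → differential x w S = c S)
    {z : Finset V → M} (hz : differential x z = 0) :
    ∃ y, ∀ S, n < #S → differential x y S = z S := by
  obtain ⟨z', rfl⟩ : ∃ z', p ∘ z' = z := ⟨_, funext fun S => (hp (z S)).choose_spec⟩
  rw [differential_comp] at hz
  have differential_incl := differential_comp (M := LinearMap.ker p) x (Submodule.subtype _)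
  let c : Finset V → LinearMap.ker p := fun S => ⟨differential x z' S, congrFun hz S⟩
  obtain ⟨w, hw⟩ := hker c <| funext fun S => Subtype.ext <|
    (congrFun (differential_incl c) S).symm.trans
      (congrFun (differential_differential x z') S)
  obtain ⟨y, hy⟩ := (hT.finsupp ι).exists_differential_eq (n := n)
    (z := z' - (LinearMap.ker p).subtype ∘ w) fun S hS => by
      rw [map_sub, differential_incl w, Pi.sub_apply, Function.comp_apply, hw S hS]
      exact sub_self _
  refine ⟨p ∘ y, fun S hS => ?_⟩
  rw [differential_comp, Function.comp_apply, hy S hS, Pi.sub_apply, map_sub]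
  exact (congrArg _ (w S).2).trans (sub_zero _)

theorem IsDivisionFamily.exists_differential_eq_of_hasProjectiveDimensionLT
    (hT : IsDivisionFamily x T) : ∀ (n : ℕ) {M : Type u} [AddCommGroup M] [Module R M]
      [HasProjectiveDimensionLT (ModuleCat.of R M) n] {z : Finset V → M},
      differential x z = 0 → ∃ y, ∀ S, n ≤ #S → differential x y S = z S
  | 0, M, _, _, hM, z, _ => by
    have : Subsingleton M := ModuleCat.isZero_iff_subsingleton.1
      ((hasProjectiveDimensionLT_zero_iff_isZero _).1 hM)
    exact ⟨0, fun S _ => Subsingleton.elim _ _⟩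
  | 1, M, _, _, hM, z, hz => by
    have : Module.Projective R M := by
      rwa [IsProjective.iff_projective, projective_iff_hasProjectiveDimensionLT_one]
    obtain ⟨s, hs⟩ := Module.projective_lifting_property
      (Finsupp.linearCombination R (id : M → M)) LinearMap.id
      (Finsupp.linearCombination_id_surjective _ M)
    exact hT.exists_differential_eq_of_retract _ s hs (n := 0) fun S _ => congrFun hz S
  | n + 2, M, _, _, hM, z, hz => by
    have hp := Finsupp.linearCombination_id_surjective R M
    have : HasProjectiveDimensionLT
        (ModuleCat.of R (LinearMap.ker (Finsupp.linearCombination R (id : M → M)))) (n + 1) := by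
      refine (LinearMap.shortExact_shortComplexKer hp).hasProjectiveDimensionLT_X₁ (n + 1) ?_ hM
      have : Projective (ModuleCat.of R (M →₀ R)) := by
        rw [← IsProjective.iff_projective]; infer_instance
      exact hasProjectiveDimensionLT_of_ge _ 1 _ (by omega)
    exact hT.exists_differential_eq_of_ker hp
      (fun _ => hT.exists_differential_eq_of_hasProjectiveDimensionLT (n + 1)) hz

end ProjectiveDimension

end Koszul

namespace Koszul

variable {V : Type*} [LinearOrder V] {M : Type*} [AddCommGroup M]

theorem wedge_apply_eq_zero {v : V} {f : Finset V → M} {S : Finset V}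
    (hf : v ∈ S → f (S.erase v) = 0) : wedge v f S = 0 := by
  rw [wedge_apply]
  split_ifs with hv
  · rw [hf hv, smul_zero]
  · rfl

variable [Fintype V]

theorem differential_apply_eq_zero_of_ssubset {R : Type*} [CommRing R] [Module R M] (x : V → R)
    {f : Finset V → M} {S : Finset V} (hf : ∀ T, S ⊂ T → f T = 0) : differential x f S = 0 := by
  refine (differential_apply x f S).trans (Finset.sum_eq_zero fun v _ => ?_)
  rw [contract_apply]
  split_ifs with hv
  · exact smul_zero _
  · rw [hf _ (Finset.ssubset_insert hv), smul_zero, smul_zero]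

theorem exists_differential_eq_of_collapse {P Q : Set (Finset V)} (hP : IsLowerSet P)
    (hQ : IsLowerSet Q) {v : V} (hinsert : ∀ S ∈ Q \ P, insert v S ∈ Q)
    (herase : ∀ S ∈ Q \ P, S.erase v ∉ P) {f : Finset V → M} (hfQ : ∀ S ∉ Q, f S = 0)
    (hf : differential (1 : V → ℤ) f = 0) :
    ∃ g, (∀ S ∉ Q, g S = 0) ∧ ∀ S ∉ P, differential (1 : V → ℤ) g S = f S := by
  classical
  let h : Finset V → M := fun S => if S ∈ P then 0 else f S
  have mem_of_ne_zero : ∀ S, h S ≠ 0 → S ∈ Q \ P := fun S hS => by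
    simp only [h, ne_eq, ite_eq_left_iff, Classical.not_imp] at hS
    exact ⟨not_imp_comm.1 (hfQ S) hS.2, hS.1⟩
  refine ⟨wedge v h, fun S hS => wedge_apply_eq_zero fun hv => by_contra fun hne => hS ?_,
    fun S hS => ?_⟩
  · rw [← Finset.insert_erase hv]
    exact hinsert _ (mem_of_ne_zero _ hne)
  have wedge_differential : wedge v (differential (1 : V → ℤ) h) S = 0 := by
    refine wedge_apply_eq_zero fun _ => ?_
    by_cases hSP : S.erase v ∈ P
    · have hSQ : S ∉ Q := fun hSQ => herase S ⟨hSQ, hS⟩ hSP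
      refine differential_apply_eq_zero_of_ssubset _ fun T hT => by_contra fun hne => hSQ ?_
      exact hQ (Finset.subset_insert_iff.2 hT.subset) (hinsert T (mem_of_ne_zero T hne))
    · have hd : differential (1 : V → ℤ) (h - f) (S.erase v) = 0 :=
        differential_apply_eq_zero_of_ssubset _ fun T hT => sub_eq_zero.2 <|
          if_neg fun hTP => hSP (hP hT.subset hTP)
      rwa [map_sub, hf, sub_zero] at hd
  have homotopy := isDivisionFamily_one.differential_wedge v h S
  rw [wedge_differential, map_zero, add_zero, Pi.one_apply, one_smul] at homotopy
  exact homotopy.trans ((ite_self _).trans (if_neg hS))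

end Koszul

theorem induction_Iio_Iic {ι : Type*} [LinearOrder ι] [Finite ι] {p : Set ι → Prop}
    (empty : p ∅) (Iic : ∀ i, p (Set.Iio i) → p (Set.Iic i)) : p Set.univ := by
  have := Fintype.ofFinite ι
  suffices H : ∀ t : Finset ι, IsLowerSet (t : Set ι) → p t by
    simpa using H Finset.univ (by simp [isLowerSet_univ])
  intro t
  induction t using Finset.induction_on_max with
  | empty => exact fun _ => by simpa using empty
  | insert i t hlt ih =>
    intro hlow
    have hIic : ((insert i t : Finset ι) : Set ι) = Set.Iic i :=
      (hlow.Iic_subset (Finset.mem_insert_self i t)).antisymm' fun j hj =>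
        (Finset.mem_insert.1 hj).elim le_of_eq fun hj => (hlt j hj).le
    have hIio : (t : Set ι) = Set.Iio i := by
      rw [← Set.Iic_sdiff_right, ← hIic, Finset.coe_insert,
        Set.insert_sdiff_self_of_notMem fun hi => (hlt i hi).false]
    rw [hIic]
    exact Iic i (hIio ▸ ih (hIio ▸ isLowerSet_Iio i))

section Shelling

variable {ι V : Type*} [LinearOrder ι]

/-- `G` enumerates the facets of a simplicial complex in a shelling order with restriction sets
`R`: a face `S` of `G i` lies in no earlier `G j` if and only if `S` contains `R i`. -/
structure IsShelling (G R : ι → Finset V) : Prop where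
  eq_of_subset : ∀ {i j}, G i ⊆ G j → i = j
  subset_iff : ∀ {i S}, S ⊆ G i → (R i ⊆ S ↔ ∀ j < i, ¬ S ⊆ G j)

namespace IsShelling

open Koszul

variable {G R : ι → Finset V} (h : IsShelling G R)
include h

theorem subset (i : ι) : R i ⊆ G i :=
  (h.subset_iff subset_rfl).2 fun _ hj hG => hj.ne' (h.eq_of_subset hG)

theorem mem_diff_iff {i : ι} {S : Finset V} :
    S ∈ {S | ∃ j ≤ i, S ⊆ G j} \ {S | ∃ j < i, S ⊆ G j} ↔ S ⊆ G i ∧ R i ⊆ S := by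
  refine ⟨fun ⟨⟨j, hj, hS⟩, hlt⟩ => ?_, fun ⟨hS, hR⟩ => ⟨⟨i, le_rfl, hS⟩, ?_⟩⟩
  · obtain rfl := hj.eq_of_not_lt fun hj => hlt ⟨j, hj, hS⟩
    exact ⟨hS, (h.subset_iff hS).2 fun k hk hSk => hlt ⟨k, hk, hSk⟩⟩
  · rintro ⟨j, hj, hSj⟩
    exact (h.subset_iff hS).1 hR j hj hSj

variable [LinearOrder V] [Fintype V] {M : Type*} [AddCommGroup M]

theorem differential_facet_eq_zero {f : Finset V → M} (hf : ∀ S, f S ≠ 0 → ∃ i, S ⊆ G i) (i : ι) :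
    differential (1 : V → ℤ) f (G i) = 0 := by
  refine differential_apply_eq_zero_of_ssubset _ fun T hT => by_contra fun hfT => ?_
  obtain ⟨j, hj⟩ := hf T hfT
  obtain rfl := h.eq_of_subset (hT.subset.trans hj)
  exact hT.not_subset hj

/-- If `R i ≠ G i`, attaching the facet `G i` to the earlier ones is a collapse in reverse. -/
theorem exists_sub_differential {i : ι} {f : Finset V → M}
    (hf : differential (1 : V → ℤ) f = 0) (hfG : ∀ S, f S ≠ 0 → ∃ j ≤ i, S ⊆ G j)
    (hfacet : f (G i) = 0) :
    ∃ g, (∀ S, g S ≠ 0 → ∃ j ≤ i, S ⊆ G j) ∧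
      ∀ S, (f - differential (1 : V → ℤ) g : Finset V → M) S ≠ 0 → ∃ j < i, S ⊆ G j := by
  obtain hR | hR := (h.subset i).eq_or_ssubset
  · refine ⟨0, fun S hS => absurd rfl hS, fun S hS => ?_⟩
    rw [map_zero, sub_zero] at hS
    by_contra hlt
    obtain ⟨hSG, hRS⟩ := h.mem_diff_iff.1 ⟨hfG S hS, hlt⟩
    exact hS (hSG.antisymm (hR ▸ hRS) ▸ hfacet)
  · obtain ⟨v, hvG, hvR⟩ := Finset.exists_of_ssubset hR
    obtain ⟨g, hg, hdg⟩ := exists_differential_eq_of_collapse (v := v)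
      (P := {S | ∃ j < i, S ⊆ G j}) (Q := {S | ∃ j ≤ i, S ⊆ G j})
      (fun S T hTS ⟨j, hj, hS⟩ => ⟨j, hj, hTS.trans hS⟩)
      (fun S T hTS ⟨j, hj, hS⟩ => ⟨j, hj, hTS.trans hS⟩)
      (fun S hS => ⟨i, le_rfl, Finset.insert_subset hvG (h.mem_diff_iff.1 hS).1⟩)
      (fun S hS => (h.mem_diff_iff.2 ⟨(Finset.erase_subset v S).trans (h.mem_diff_iff.1 hS).1,
        Finset.subset_erase.2 ⟨(h.mem_diff_iff.1 hS).2, hvR⟩⟩).2)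
      (fun S => not_imp_comm.1 (hfG S)) hf
    refine ⟨g, fun S => not_imp_comm.1 (hg S), fun S hS => ?_⟩
    by_contra hlt
    exact hS (sub_eq_zero.2 (hdg S hlt).symm)

theorem exists_differential_eq [Finite ι] {f : Finset V → M}
    (hf : differential (1 : V → ℤ) f = 0) (hfG : ∀ S, f S ≠ 0 → ∃ i, S ⊆ G i)
    (hfacet : ∀ i, f (G i) = 0) :
    ∃ g, (∀ S, g S ≠ 0 → ∃ i, S ⊆ G i) ∧ differential (1 : V → ℤ) g = f := by
  have H := induction_Iio_Iic (p := fun t : Set ι => ∀ f : Finset V → M,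
    differential (1 : V → ℤ) f = 0 → (∀ S, f S ≠ 0 → ∃ i ∈ t, S ⊆ G i) → (∀ i, f (G i) = 0) →
    ∃ g, (∀ S, g S ≠ 0 → ∃ i, S ⊆ G i) ∧ differential (1 : V → ℤ) g = f)
  refine H (fun f _ hfG _ => ?_) (fun i ih f hf hfG hfacet => ?_) f hf (by simpa using hfG) hfacet
  · have : f = 0 := funext fun S => by_contra fun hS => by simpa using hfG S hS
    exact ⟨0, fun S hS => absurd rfl hS, by rw [this, map_zero]⟩
  · obtain ⟨g, hg, hfg⟩ := h.exists_sub_differential hf hfG (hfacet i)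
    replace hg : ∀ S, g S ≠ 0 → ∃ j, S ⊆ G j := fun S hS => (hg S hS).imp fun _ => And.right
    obtain ⟨g', hg', hfg'⟩ := ih (f - differential (1 : V → ℤ) g)
      (by rw [map_sub, hf, differential_differential, sub_zero]) hfg fun j => by
        rw [Pi.sub_apply, hfacet, h.differential_facet_eq_zero hg, sub_zero]
    refine ⟨g + g', fun S hS => ?_, by rw [map_add, hfg', add_sub_cancel]⟩
    by_cases hgS : g S = 0
    · exact hg' S (by simpa [hgS] using hS)
    · exact hg S hgS

end IsShelling

end Shelling

/-- A family `F` of finite sets for which the monomials `x^{F i}` have linear quotients, the colon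
ideal of `x^{F i}` being generated by the variables in `A i`. In combinatorial terms: `F i ∪ S`
contains an earlier member of the family if and only if `S` meets `A i`. -/
structure IsLinearQuotientFamily {ι V : Type*} [LT ι] [DecidableEq V] (F A : ι → Finset V) :
    Prop where
  eq_of_subset : ∀ {i j}, F i ⊆ F j → i = j
  exists_subset_union_iff : ∀ {i S}, (∃ j < i, F j ⊆ F i ∪ S) ↔ ¬ Disjoint (A i) S

namespace IsLinearQuotientFamily

open Koszul

variable {ι V : Type*} [LinearOrder ι] {F A : ι → Finset V}

section

variable [DecidableEq V] (h : IsLinearQuotientFamily F A)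
include h

theorem disjoint (i : ι) : Disjoint (A i) (F i) := by
  by_contra hAF
  obtain ⟨j, hj, hFj⟩ := h.exists_subset_union_iff.2 hAF
  rw [Finset.union_self] at hFj
  exact hj.ne (h.eq_of_subset hFj)

/-- The complex generated by these complements computes the Betti numbers in multidegree `σ` of the
ideal of the earlier monomials. -/
theorem isShelling (i : ι) (σ : Finset V) :
    IsShelling (fun l : {l // l < i ∧ F l ⊆ σ} => σ \ F l) fun l => A l ∩ σ where
  eq_of_subset {j k} hjk := by
    refine Subtype.ext (h.eq_of_subset fun v hv => ?_).symm
    by_contra hvj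
    exact (Finset.mem_sdiff.1 (hjk (Finset.mem_sdiff.2 ⟨k.2.2 hv, hvj⟩))).2 hv
  subset_iff {l S} hS := by
    obtain ⟨hSσ, hSl⟩ := Finset.subset_sdiff.1 hS
    have union_eq : F l ∪ σ \ S = σ \ S :=
      Finset.union_eq_right.2 (Finset.subset_sdiff.2 ⟨l.2.2, hSl.symm⟩)
    have disjoint_iff : Disjoint (A l) (σ \ S) ↔ A l ∩ σ ⊆ S := by
      rw [Finset.disjoint_left, Finset.subset_iff]
      simp only [Finset.mem_inter, Finset.mem_sdiff, not_and, not_not, and_imp]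
    rw [← disjoint_iff, ← not_iff_not, ← h.exists_subset_union_iff, union_eq]
    push Not
    refine ⟨fun ⟨j, hj, hFj⟩ => ?_, fun ⟨j, hj, hSj⟩ => ⟨j, hj, ?_⟩⟩
    · have hFσ := Finset.subset_sdiff.1 hFj
      exact ⟨⟨j, hj.trans l.2.1, hFσ.1⟩, hj, Finset.subset_sdiff.2 ⟨hSσ, hFσ.2.symm⟩⟩
    · exact Finset.subset_sdiff.2 ⟨j.2.2, (Finset.subset_sdiff.1 hSj).2.symm⟩

theorem exists_subset_sdiff_of_ssubset {i : ι} {S : Finset V} (hS : S ⊂ A i) :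
    ∃ l < i, F l ⊆ F i ∪ A i ∧ S ⊆ (F i ∪ A i) \ F l := by
  obtain ⟨a, haA, haS⟩ := Finset.exists_of_ssubset hS
  obtain ⟨l, hl, hFl⟩ := h.exists_subset_union_iff.2
    (Finset.not_disjoint_iff.2 ⟨a, haA, Finset.mem_singleton_self a⟩)
  have hFS : Disjoint S (F i ∪ {a}) := Finset.disjoint_union_right.2
    ⟨(h.disjoint i).mono_left hS.subset, Finset.disjoint_singleton_right.2 haS⟩
  exact ⟨l, hl,
    hFl.trans (Finset.union_subset_union_right (Finset.singleton_subset_iff.2 haA)),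
    Finset.subset_sdiff.2 ⟨hS.subset.trans Finset.subset_union_right, hFS.mono_right hFl⟩⟩

end

/-- The boundary of the simplex on `A i` lies in the complex of `isShelling` and vanishes on its
facets, so it bounds a chain there; the simplex minus this chain is the cycle sought. -/
theorem exists_cycle [Finite ι] [LinearOrder V] [Fintype V] (h : IsLinearQuotientFamily F A)
    (i : ι) :
    ∃ z : Finset V → ℤ, differential (1 : V → ℤ) z = 0 ∧ z (A i) = 1 ∧
      ∀ S, z S ≠ 0 → ∃ l, F l ⊆ F i ∪ A i ∧ S ⊆ (F i ∪ A i) \ F l := by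
  set σ := F i ∪ A i
  have hAF : A i ⊆ σ \ F i := (Finset.union_sdiff_cancel_left (h.disjoint i).symm).ge
  let δ : Finset V → ℤ := Pi.single (A i) 1
  have hsupp : ∀ S, differential (1 : V → ℤ) δ S ≠ 0 →
      ∃ l : {l // l < i ∧ F l ⊆ σ}, S ⊆ σ \ F l := fun S hS => by
    have hSA : S ⊂ A i := by
      by_contra hSA
      refine hS (differential_apply_eq_zero_of_ssubset _ fun T hT => ?_)
      exact Pi.single_eq_of_ne (by rintro rfl; exact hSA hT) _
    obtain ⟨l, hl, hlσ, hSl⟩ := h.exists_subset_sdiff_of_ssubset hSA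
    exact ⟨⟨l, hl, hlσ⟩, hSl⟩
  have hfacet : ∀ l : {l // l < i ∧ F l ⊆ σ}, differential (1 : V → ℤ) δ (σ \ F l) = 0 := by
    refine fun l => differential_apply_eq_zero_of_ssubset _ fun T hT =>
      Pi.single_eq_of_ne (fun hTA => l.2.1.ne' (h.eq_of_subset fun v hv => ?_)) _
    by_contra hvl
    have hvA : v ∈ A i := hTA ▸ hT.subset (Finset.mem_sdiff.2 ⟨Finset.mem_union_left _ hv, hvl⟩)
    exact (Finset.mem_sdiff.1 (hAF hvA)).2 hv
  obtain ⟨g, hg, hdg⟩ := (h.isShelling i σ).exists_differential_eq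
    (differential_differential _ δ) hsupp hfacet
  have hgA : g (A i) = 0 := by
    by_contra hne
    obtain ⟨l, hl⟩ := hg _ hne
    refine l.2.1.ne (h.eq_of_subset fun v hv => ?_)
    exact (Finset.mem_union.1 (l.2.2 hv)).resolve_right fun hvA =>
      (Finset.mem_sdiff.1 (hl hvA)).2 hv
  refine ⟨δ - g, by rw [map_sub, hdg, sub_self], by simp [δ, hgA], fun S hS => ?_⟩
  by_cases hSA : S = A i
  · exact ⟨i, Finset.subset_union_left, hSA ▸ hAF⟩
  · obtain ⟨l, hl⟩ := hg S (by simpa [δ, hSA] using hS)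
    exact ⟨l, l.2.2, hl⟩

end IsLinearQuotientFamily

namespace MonomialIdeal

/-- The exponent vector of the squarefree monomial with support `F`. -/
noncomputable def expo {V : Type*} (F : Finset V) : V →₀ ℕ := Finsupp.indicator F fun _ _ => 1

section SquarefreeIdeal

variable {V : Type*}

theorem expo_apply [DecidableEq V] (F : Finset V) (v : V) : expo F v = if v ∈ F then 1 else 0 := by
  rw [expo, Finsupp.indicator_apply]; split_ifs <;> rfl

theorem support_expo (F : Finset V) : (expo F).support = F := by
  classical
  ext v
  simp [expo_apply]

theorem expo_injective : Function.Injective (expo : Finset V → V →₀ ℕ) :=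
  Function.LeftInverse.injective support_expo

theorem expo_le_iff {F : Finset V} {e : V →₀ ℕ} : expo F ≤ e ↔ F ⊆ e.support := by
  classical
  refine forall_congr' fun v => ?_
  rw [expo_apply, Finsupp.mem_support_iff]
  split_ifs with hv <;> simp [hv, Nat.one_le_iff_ne_zero]

theorem single_add_expo_erase [DecidableEq V] {F : Finset V} {v : V} (hv : v ∈ F) :
    Finsupp.single v 1 + expo (F.erase v) = expo F := by
  ext w
  obtain rfl | hw := eq_or_ne w v
  · simp [expo_apply, hv]
  · simp [expo_apply, hw]

variable {K : Type*} [CommRing K]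

theorem prod_X_eq_monomial_expo (F : Finset V) :
    ∏ i ∈ F, (X i : MvPolynomial V K) = monomial (expo F) 1 := by
  rw [expo, Finsupp.indicator_eq_sum_single F fun _ => 1, monomial_sum_one]
  rfl

/-- The ideal generated by the squarefree monomials `x^F = ∏_{i ∈ F} x_i` with `F ∈ 𝒢`. -/
noncomputable def squarefreeIdeal (K : Type*) [CommRing K] (𝒢 : Set (Finset V)) :
    Ideal (MvPolynomial V K) :=
  Ideal.span ((fun F => ∏ i ∈ F, X i) '' 𝒢)

theorem squarefreeIdeal_insert (F : Finset V) (𝒢 : Set (Finset V)) :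
    squarefreeIdeal K (insert F 𝒢) = squarefreeIdeal K 𝒢 ⊔ Ideal.span {∏ i ∈ F, X i} := by
  rw [squarefreeIdeal, Set.image_insert_eq, Ideal.span_insert, sup_comm, squarefreeIdeal]

theorem squarefreeIdeal_eq_span_monomial (𝒢 : Set (Finset V)) :
    squarefreeIdeal K 𝒢 = Ideal.span ((fun e => monomial e 1) '' (expo '' 𝒢)) := by
  simp only [squarefreeIdeal, prod_X_eq_monomial_expo, Set.image_image]

variable {𝒢 : Set (Finset V)} {F : Finset V}

theorem mem_squarefreeIdeal {p : MvPolynomial V K} :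
    p ∈ squarefreeIdeal K 𝒢 ↔ ∀ e ∈ p.support, ∃ G ∈ 𝒢, G ⊆ e.support := by
  rw [squarefreeIdeal_eq_span_monomial, mem_ideal_span_monomial_image]
  simp only [Set.exists_mem_image, expo_le_iff]

theorem monomial_mem_squarefreeIdeal {e : V →₀ ℕ} {G : Finset V} (hG : G ∈ 𝒢)
    (he : G ⊆ e.support) (a : K) : monomial e a ∈ squarefreeIdeal K 𝒢 :=
  mem_squarefreeIdeal.2 fun d hd => by
    rw [Finset.mem_singleton.1 (support_monomial_subset hd)]
    exact ⟨G, hG, he⟩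

theorem mem_colon_prod_X [DecidableEq V] {p : MvPolynomial V K} :
    p ∈ (squarefreeIdeal K 𝒢).colon {∏ i ∈ F, X i} ↔
      ∀ e ∈ p.support, ∃ G ∈ 𝒢, G ⊆ F ∪ e.support := by
  rw [Submodule.mem_colon_singleton, smul_eq_mul, prod_X_eq_monomial_expo, mem_squarefreeIdeal]
  have support_add (e : V →₀ ℕ) : (e + expo F).support = F ∪ e.support := by
    ext v
    by_cases hv : v ∈ F <;> simp [expo_apply, hv]
  simp only [mem_support_iff]
  refine ⟨fun h e he => support_add e ▸ h (e + expo F) ?_, fun h e he => ?_⟩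
  · rwa [coeff_mul_monomial, mul_one]
  · rw [coeff_mul_monomial', mul_one] at he
    obtain ⟨hFe, he⟩ := ite_ne_right_iff.1 he
    rw [← tsub_add_cancel_of_le hFe, support_add]
    exact h _ he

theorem colon_eq_span_X_iff [DecidableEq V] [Nontrivial K] {A : Finset V} :
    (squarefreeIdeal K 𝒢).colon {∏ i ∈ F, X i} = Ideal.span (X '' (A : Set V)) ↔
      ∀ S, (∃ G ∈ 𝒢, G ⊆ F ∪ S) ↔ ¬ Disjoint A S := by
  have mem_span_iff (p : MvPolynomial V K) :
      p ∈ Ideal.span (X '' (A : Set V)) ↔ ∀ e ∈ p.support, ¬ Disjoint A e.support := by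
    simp only [mem_ideal_span_X_image, Finset.not_disjoint_iff, Finsupp.mem_support_iff,
      Finset.mem_coe]
  refine ⟨fun h S => ?_, fun h => Ideal.ext fun p => ?_⟩
  · have hS := mem_span_iff (monomial (expo S) 1)
    rw [← h, mem_colon_prod_X] at hS
    simpa [support_monomial, support_expo] using hS
  · simp only [mem_span_iff, mem_colon_prod_X, h]

/-- Minimal generators of `I` do not lie in `𝔪 I`. -/
theorem coeff_expo_X_mul_eq_zero (hF : ∀ G ∈ 𝒢, ¬ G ⊂ F) {p : MvPolynomial V K}
    (hp : p ∈ squarefreeIdeal K 𝒢) (v : V) : coeff (expo F) (X v * p) = 0 := by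
  classical
  rw [coeff_X_mul', support_expo]
  refine ite_eq_right_iff.2 fun hv => notMem_support_iff.1 fun hmem => ?_
  obtain ⟨G, hG, hGF⟩ := mem_squarefreeIdeal.1 hp _ hmem
  rw [← single_add_expo_erase hv, add_tsub_cancel_left, support_expo] at hGF
  exact hF G hG (hGF.trans_ssubset (Finset.erase_ssubset hv))

open Koszul

section Differential

variable [LinearOrder V] [Fintype V]

theorem coe_differential {I : Ideal (MvPolynomial V K)} (f : Finset V → I) (S : Finset V) :
    (differential (R := MvPolynomial V K) (M := I) X f S : MvPolynomial V K) =
      differential (X : V → MvPolynomial V K) (fun S => (f S : MvPolynomial V K)) S :=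
  (congrFun (differential_comp X (Submodule.subtype I) f) S).symm

theorem coeff_expo_differential_eq_zero (hF : ∀ G ∈ 𝒢, ¬ G ⊂ F)
    (f : Finset V → squarefreeIdeal K 𝒢) (S : Finset V) :
    coeff (expo F) (differential (R := MvPolynomial V K) (M := squarefreeIdeal K 𝒢) X f S :
      MvPolynomial V K) = 0 := by
  rw [coe_differential, differential_apply, coeff_sum]
  refine Finset.sum_eq_zero fun v _ => coeff_expo_X_mul_eq_zero hF ?_ v
  rw [contract_apply]
  split_ifs
  · exact zero_mem _
  · exact zsmul_mem (f _).2 _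

theorem differential_monomial_expo {σ : Finset V}
    {z : Finset V → ℤ} (hz : ∀ S, z S ≠ 0 → S ⊆ σ) (S : Finset V) :
    differential (X : V → MvPolynomial V K) (fun S => monomial (expo (σ \ S)) (z S : K)) S =
      monomial (expo (σ \ S)) ((differential (1 : V → ℤ) z S : ℤ) : K) := by
  simp only [differential_apply, Int.cast_sum, map_sum]
  refine Finset.sum_congr rfl fun v _ => ?_
  rw [contract_apply, contract_apply, Pi.one_apply, one_smul]
  split_ifs with hv
  · simp
  by_cases hS : insert v S ⊆ σ
  · have hvσ : v ∈ σ \ S :=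
      Finset.mem_sdiff.2 ⟨hS (Finset.mem_insert_self v S), hv⟩
    rw [Finset.sdiff_insert, smul_eq_mul, smul_eq_mul, Int.cast_mul, ← zsmul_eq_mul, map_zsmul,
      mul_smul_comm, X, monomial_mul, one_mul, single_add_expo_erase hvσ]
  · simp [not_imp_comm.1 (hz _) hS]

end Differential

end SquarefreeIdeal

end MonomialIdeal

namespace IsLinearQuotientFamily

open MonomialIdeal Koszul

variable {ι V K : Type*} [LinearOrder ι] {F A : ι → Finset V}

section

variable [DecidableEq V] [CommRing K] [Nontrivial K] (h : IsLinearQuotientFamily F A)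
include h

variable (K) in
theorem colon_eq_span_X (i : ι) :
    (squarefreeIdeal K (F '' Set.Iio i)).colon {∏ v ∈ F i, X v} =
      Ideal.span (X '' (A i : Set V)) := by
  rw [colon_eq_span_X_iff]
  intro S
  rw [← h.exists_subset_union_iff, Set.exists_mem_image]
  rfl

theorem hasProjectiveDimensionLT [Finite ι] {n : ℕ} (hn : ∀ i, #(A i) < n) :
    HasProjectiveDimensionLT
      (ModuleCat.of (MvPolynomial V K) (squarefreeIdeal K (Set.range F))) n := by
  rw [← Set.image_univ]
  refine induction_Iio_Iic (p := fun t => HasProjectiveDimensionLT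
    (ModuleCat.of (MvPolynomial V K) (squarefreeIdeal K (F '' t))) n) ?_ fun i ih => ?_
  · rw [Set.image_empty, squarefreeIdeal, Set.image_empty, Ideal.span_empty]
    have hbot := ModuleCat.isZero_of_subsingleton
      (ModuleCat.of (MvPolynomial V K) (⊥ : Ideal (MvPolynomial V K)))
    have := hbot.hasProjectiveDimensionLT_zero
    exact hasProjectiveDimensionLT_of_ge _ 0 n n.zero_le
  · obtain ⟨n, rfl⟩ := Nat.exists_eq_succ_of_ne_zero (hn i).ne_bot
    rw [← Set.Iio_insert, Set.image_insert_eq, squarefreeIdeal_insert]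
    refine hasProjectiveDimensionLT_sup_span ?_ ih
    rw [h.colon_eq_span_X K i]
    have := hasProjectiveDimensionLT_span_X (R := K) (A i)
    exact hasProjectiveDimensionLT_of_ge _ _ _ (Nat.le_of_lt_succ (hn i))

end

section

variable [Finite ι] [LinearOrder V] [CommRing K] (h : IsLinearQuotientFamily F A)
include h

variable (K) in
theorem exists_cycle_squarefreeIdeal [Fintype V] (i : ι) :
    ∃ c : Finset V → squarefreeIdeal K (Set.range F),
      differential (R := MvPolynomial V K) X c = 0 ∧
        (c (A i) : MvPolynomial V K) = monomial (expo (F i)) 1 := by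
  obtain ⟨z, hz, hzA, hzF⟩ := h.exists_cycle i
  set σ := F i ∪ A i
  have hσA : σ \ A i = F i := Finset.union_sdiff_cancel_right (h.disjoint i).symm
  have hmem (S) : monomial (expo (σ \ S)) (z S : K) ∈ squarefreeIdeal K (Set.range F) := by
    by_cases hS : z S = 0
    · simp [hS]
    · obtain ⟨l, hl, hSl⟩ := hzF S hS
      refine monomial_mem_squarefreeIdeal (Set.mem_range_self l) ?_ _
      rw [support_expo]
      exact Finset.subset_sdiff.2 ⟨hl, (Finset.subset_sdiff.1 hSl).2.symm⟩
  have hzσ (S) (hS : z S ≠ 0) : S ⊆ σ :=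
    (hzF S hS).elim fun l hl => hl.2.trans Finset.sdiff_subset
  refine ⟨fun S => ⟨_, hmem S⟩, funext fun S => Subtype.ext ?_, by simp [hσA, hzA]⟩
  rw [coe_differential, differential_monomial_expo hzσ S, hz]
  simp

theorem card_lt_of_hasProjectiveDimensionLT [Finite V] [Nontrivial K] {n : ℕ}
    (hn : HasProjectiveDimensionLT
      (ModuleCat.of (MvPolynomial V K) (squarefreeIdeal K (Set.range F))) n) (i : ι) :
    #(A i) < n := by
  have := Fintype.ofFinite V
  by_contra! hle
  obtain ⟨c, hc, hcA⟩ := h.exists_cycle_squarefreeIdeal K i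
  obtain ⟨y, hy⟩ := isDivisionFamily_X.exists_differential_eq_of_hasProjectiveDimensionLT n hc
  have hmin : ∀ G ∈ Set.range F, ¬ G ⊂ F i := by
    rintro _ ⟨l, rfl⟩ hl
    exact hl.ne (congrArg F (h.eq_of_subset hl.subset))
  have hcoeff := coeff_expo_differential_eq_zero hmin y (A i)
  rw [hy _ hle, hcA, coeff_monomial, if_pos rfl] at hcoeff
  exact one_ne_zero hcoeff

end

theorem pd_squarefreeIdeal {ι V K : Type*} [LinearOrder ι] [Fintype ι] [Nonempty ι] [DecidableEq V]
    [Finite V] [Field K] {F A : ι → Finset V} (h : IsLinearQuotientFamily F A) :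
    pd (squarefreeIdeal K (Set.range F)) = (Finset.univ.sup fun i => #(A i) : ℕ) := by
  refine le_antisymm ((projectiveDimension_le_iff _ _).2 (h.hasProjectiveDimensionLT fun i =>
    Nat.lt_succ_of_le (Finset.le_sup (f := fun i => #(A i)) (Finset.mem_univ i))))
    ((projectiveDimension_ge_iff _ _).2 fun hpd => ?_)
  have := Fintype.ofFinite V
  let : LinearOrder V := LinearOrder.lift' _ (Fintype.equivFin V).injective
  obtain rfl : ‹DecidableEq V› = LinearOrder.toDecidableEq := Subsingleton.elim _ _
  obtain ⟨i, -, hi⟩ := Finset.exists_mem_eq_sup _ Finset.univ_nonempty fun i => #(A i)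
  exact (h.card_lt_of_hasProjectiveDimensionLT hpd i).ne' hi

end IsLinearQuotientFamily

namespace FaceComplex

open MonomialIdeal

section FacetIdeal

variable {V K : Type*} [Field K] (Δ : FaceComplex V)

theorem isAntichain_facets : IsAntichain (· ⊆ ·) Δ.facets := setOfPred_maximal_antichain _

theorem facetIdeal_eq_squarefreeIdeal : Δ.facetIdeal K = squarefreeIdeal K Δ.facets := rfl

theorem monomial_one_mem_facetIdeal {e : V →₀ ℕ} :
    monomial e (1 : K) ∈ Δ.facetIdeal K ↔ ∃ F ∈ Δ.facets, expo F ≤ e := by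
  classical
  simp [facetIdeal_eq_squarefreeIdeal, mem_squarefreeIdeal, support_monomial, expo_le_iff]

theorem minGens_facetIdeal : minGens (Δ.facetIdeal K) = expo '' Δ.facets := by
  ext e
  simp only [minGens, monomial_one_mem_facetIdeal, Set.mem_ofPred_eq]
  refine ⟨fun he => ?_, ?_⟩
  · obtain ⟨F, hF, hle⟩ := he.prop
    exact ⟨F, hF, he.eq_of_le ⟨F, hF, le_rfl⟩ hle⟩
  · rintro ⟨F, hF, rfl⟩
    refine ⟨⟨F, hF, le_rfl⟩, fun e ⟨G, hG, hGe⟩ hle => ?_⟩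
    have hGF : G ⊆ F := support_expo F ▸ expo_le_iff.1 (hGe.trans hle)
    rwa [← Δ.isAntichain_facets.eq hG hF hGF]

theorem exists_isLinearQuotientFamily [Finite V] [DecidableEq V]
    (h : HasLinearQuotients (Δ.facetIdeal K)) :
    ∃ (m : ℕ) (F A : Fin m → Finset V),
      IsLinearQuotientFamily F A ∧ Set.range F = Δ.facets := by
  obtain ⟨m, f, hf, hrange, hcolon⟩ := h
  rw [minGens_facetIdeal] at hrange
  obtain ⟨F, rfl⟩ := Set.range_subset_range_iff_exists_comp.1
    (hrange.trans_subset (Set.image_subset_range _ _))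
  have hF : Set.range F = Δ.facets :=
    expo_injective.image_injective (Set.range_comp expo F ▸ hrange)
  choose A hA using hcolon
  lift A to Fin m → Finset V using fun i => (A i).toFinite
  refine ⟨m, F, A, ⟨fun {i j} hij => ?_, fun {i S} => ?_⟩, hF⟩
  · exact hf.of_comp (Δ.isAntichain_facets.eq (hF ▸ ⟨i, rfl⟩) (hF ▸ ⟨j, rfl⟩) hij)
  · have hcolon : (squarefreeIdeal K (F '' Set.Iio i)).colon {∏ v ∈ F i, X v} =
        Ideal.span (X '' (A i : Set V)) := by
      have hAi := hA i
      simp only [Function.comp_apply, ← prod_X_eq_monomial_expo] at hAi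
      rw [squarefreeIdeal, Set.image_image, ← hAi]
      exact Submodule.colon_span.symm
    rw [← colon_eq_span_X_iff.1 hcolon S, Set.exists_mem_image]
    rfl

end FacetIdeal

section Transversal

variable {V : Type*} {α : V → ℕ} {F : Finset V}

theorem mem_transversal {j : (i : F) → Fin (α i)} {p : Σ i : V, Fin (α i)} :
    p ∈ transversal α F j ↔ ∃ h : p.1 ∈ F, j ⟨p.1, h⟩ = p.2 := by
  simp only [transversal, Finset.mem_map, Finset.mem_univ, true_and]
  refine ⟨?_, fun ⟨h, hj⟩ => ⟨⟨p.1, h⟩, Sigma.ext rfl (heq_of_eq hj)⟩⟩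
  rintro ⟨x, rfl⟩
  exact ⟨x.2, rfl⟩

theorem mk_mem_transversal (j : (i : F) → Fin (α i)) (x : F) :
    (⟨x, j x⟩ : Σ i : V, Fin (α i)) ∈ transversal α F j :=
  mem_transversal.2 ⟨x.2, rfl⟩

theorem image_fst_transversal [DecidableEq V] (j : (i : F) → Fin (α i)) :
    (transversal α F j).image Sigma.fst = F := by
  refine Finset.ext fun v => Finset.mem_image.trans
    ⟨?_, fun hv => ⟨_, mk_mem_transversal j ⟨v, hv⟩, rfl⟩⟩
  rintro ⟨p, hp, rfl⟩
  exact (mem_transversal.1 hp).1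

theorem exists_transversal_subset_iff [DecidableEq V] {T : Finset (Σ i : V, Fin (α i))} :
    (∃ j, transversal α F j ⊆ T) ↔ F ⊆ T.image Sigma.fst := by
  refine ⟨fun ⟨j, hj⟩ => image_fst_transversal j ▸ Finset.image_subset_image hj, fun hF => ?_⟩
  have hT (x : F) : ∃ t, (⟨x, t⟩ : Σ i : V, Fin (α i)) ∈ T := by
    simpa using hF x.2
  choose j hj using hT
  refine ⟨j, fun p hp => ?_⟩
  obtain ⟨hpF, hjp⟩ := mem_transversal.1 hp
  simpa [hjp] using hj ⟨p.1, hpF⟩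

theorem subset_of_transversal_subset {F' : Finset V} {j : (i : F) → Fin (α i)}
    {j' : (i : F') → Fin (α i)} (h : transversal α F j ⊆ transversal α F' j') : F ⊆ F' := by
  classical
  exact image_fst_transversal j' ▸ exists_transversal_subset_iff.1 ⟨j, h⟩

theorem eq_of_transversal_subset {j j' : (i : F) → Fin (α i)}
    (h : transversal α F j ⊆ transversal α F j') : j = j' :=
  funext fun x => (mem_transversal.1 (h (mk_mem_transversal j x))).2.symm

theorem exists_lt_transversal_subset_union_iff [LinearOrder V] {j : (i : F) → Fin (α i)}
    {S : Finset (Σ i : V, Fin (α i))} :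
    (∃ j', toLex j' < toLex j ∧ transversal α F j' ⊆ transversal α F j ∪ S) ↔
      ∃ x, ∃ t < j x, ⟨x.1, t⟩ ∈ S := by
  refine ⟨fun ⟨j', ⟨x, _, hx⟩, hj'⟩ => ⟨x, j' x, hx, ?_⟩, fun ⟨x, t, ht, hS⟩ => ?_⟩
  · refine (Finset.mem_union.1 (hj' (mk_mem_transversal j' x))).resolve_left fun hmem => ?_
    exact hx.ne' (mem_transversal.1 hmem).2
  · refine ⟨Function.update j x t, Pi.toLex_update_lt_self_iff.2 ht, fun ⟨v, t'⟩ hp => ?_⟩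
    obtain ⟨hv, rfl⟩ : ∃ hv : v ∈ F, Function.update j x t ⟨v, hv⟩ = t' := mem_transversal.1 hp
    obtain rfl | hne := eq_or_ne (⟨v, hv⟩ : F) x
    · exact Finset.mem_union_right _ (by simpa using hS)
    · rw [Function.update_of_ne hne]
      exact Finset.mem_union_left _ (mk_mem_transversal j ⟨v, hv⟩)

theorem mem_facets_expansion {Δ : FaceComplex V} (hα : ∀ v, 0 < α v)
    {G : Finset (Σ i : V, Fin (α i))} :
    G ∈ (Δ.expansion α).facets ↔ ∃ F ∈ Δ.facets, ∃ j, transversal α F j = G := by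
  classical
  refine ⟨fun hG => ?_, ?_⟩
  · obtain ⟨F, hF, j, hGF⟩ := hG.prop
    obtain rfl := hG.eq_of_le ⟨F, hF, j, subset_rfl⟩ hGF
    refine ⟨F, ⟨hF, fun F' hF' hle => ?_⟩, j, rfl⟩
    let j' : (i : F') → Fin (α i) := fun x => if h : x.1 ∈ F then j ⟨x, h⟩ else ⟨0, hα x⟩
    refine subset_of_transversal_subset (j := j') (j' := j)
      (hG.le_of_ge ⟨F', hF', j', subset_rfl⟩ fun p hp => ?_)
    obtain ⟨h, hj⟩ := mem_transversal.1 hp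
    exact mem_transversal.2 ⟨hle h, by simp [j', h, hj]⟩
  · rintro ⟨F, hF, j, rfl⟩
    refine ⟨⟨F, hF.prop, j, subset_rfl⟩, ?_⟩
    rintro G ⟨F', hF', j', hG⟩ hle
    obtain rfl := hF.eq_of_le hF' (subset_of_transversal_subset (hle.trans hG))
    obtain rfl := eq_of_transversal_subset (hle.trans hG)
    exact hG

/-- The variables generating the colon ideal of the transversal `j` of `F` in the expansion, where
`A` generates the colon ideal of `F`: all copies of the vertices in `A`, and the copies of each
vertex of `F` that precede the one chosen by `j`. -/
def expansionColon [DecidableEq V] (A : Finset V) (j : (i : F) → Fin (α i)) :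
    Finset (Σ i : V, Fin (α i)) :=
  (A.sigma fun _ => Finset.univ) ∪ F.sigma fun v => {t | ∃ h : v ∈ F, t < j ⟨v, h⟩}

variable [DecidableEq V] {A : Finset V} {j : (i : F) → Fin (α i)}

theorem not_disjoint_expansionColon {S : Finset (Σ i : V, Fin (α i))} :
    ¬ Disjoint (expansionColon A j) S ↔
      ¬ Disjoint A (S.image Sigma.fst) ∨ ∃ x, ∃ t < j x, ⟨x.1, t⟩ ∈ S := by
  rw [expansionColon, Finset.disjoint_union_left, not_and_or]
  simp only [Finset.not_disjoint_iff]
  refine or_congr ?_ ?_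
  · simp
  · simp only [Sigma.exists, Finset.mem_sigma, Finset.mem_filter_univ, Subtype.exists]
    refine exists_congr fun v => ?_
    by_cases hv : v ∈ F <;> simp [hv]

theorem card_expansionColon (hAF : Disjoint A F) :
    #(expansionColon A j) = ∑ v ∈ A, α v + ∑ x, (j x : ℕ) := by
  rw [expansionColon, Finset.card_union_of_disjoint, Finset.card_sigma, Finset.card_sigma,
    ← Finset.sum_coe_sort F]
  · simp [Finset.filter_gt_eq_Iio]
  · refine Finset.disjoint_left.2 fun p hpA hpF => ?_
    exact Finset.disjoint_left.1 hAF (Finset.mem_sigma.1 hpA).1 (Finset.mem_sigma.1 hpF).1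

end Transversal

end FaceComplex

theorem exists_sigmaLex_lt_iff {ι : Type*} {κ : ι → Type*} [LT ι] [∀ i, LT (κ i)] {i : ι} {a : κ i}
    {p : (Σₗ i, κ i) → Prop} : (∃ b < toLex ⟨i, a⟩, p b) ↔
      (∃ k < i, ∃ b, p (toLex ⟨k, b⟩)) ∨ ∃ b < a, p (toLex ⟨i, b⟩) := by
  constructor
  · rintro ⟨_, ⟨b, _, hk⟩ | ⟨b, _, hb⟩, hp⟩
    · exact .inl ⟨_, hk, b, hp⟩
    · exact .inr ⟨b, hb, hp⟩
  · rintro (⟨k, hk, b, hp⟩ | ⟨b, hb, hp⟩)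
    · exact ⟨_, Sigma.Lex.left _ _ hk, hp⟩
    · exact ⟨_, Sigma.Lex.right _ _ hb, hp⟩

namespace IsLinearQuotientFamily

open FaceComplex MonomialIdeal

variable {ι V : Type*} [LinearOrder ι] [LinearOrder V] {F A : ι → Finset V}
  (h : IsLinearQuotientFamily F A) {α : V → ℕ}
include h

variable (α) in
theorem expansion :
    IsLinearQuotientFamily
      (fun p : Σₗ i, Lex ((x : F i) → Fin (α x)) =>
        transversal α (F (ofLex p).1) (ofLex (ofLex p).2))
      (fun p => expansionColon (A (ofLex p).1) (ofLex (ofLex p).2)) where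
  eq_of_subset := by
    rintro ⟨i, j⟩ ⟨i', j'⟩ hle
    obtain rfl := h.eq_of_subset (subset_of_transversal_subset hle)
    exact congrArg (Sigma.mk i) (eq_of_transversal_subset hle)
  exists_subset_union_iff {p S} := by
    obtain ⟨⟨i, j⟩, rfl⟩ := toLex.surjective p
    have exists_transversal (k : ι) :
        (∃ j', transversal α (F k) j' ⊆ transversal α (F i) (ofLex j) ∪ S) ↔
          F k ⊆ F i ∪ S.image Sigma.fst := by
      rw [exists_transversal_subset_iff, Finset.image_union, image_fst_transversal]
    refine exists_sigmaLex_lt_iff.trans (Iff.trans ?_ not_disjoint_expansionColon.symm)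
    refine or_congr ?_ exists_lt_transversal_subset_union_iff
    rw [← h.exists_subset_union_iff]
    exact exists_congr fun k => and_congr_right fun _ => exists_transversal k

variable [Fintype ι]

theorem sup_card_expansionColon (hα : ∀ v, 0 < α v) :
    (Finset.univ.sup fun p : Σₗ i, Lex ((x : F i) → Fin (α x)) =>
      #(expansionColon (A (ofLex p).1) (ofLex (ofLex p).2))) =
      Finset.univ.sup fun i => ∑ v ∈ A i, α v + ∑ v ∈ F i, (α v - 1) := by
  simp only [card_expansionColon (h.disjoint _), ← Finset.sum_coe_sort (F _)]
  refine le_antisymm (Finset.sup_le fun p _ => ?_) (Finset.sup_le fun i _ => ?_)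
  · refine le_trans ?_ (Finset.le_sup (Finset.mem_univ (ofLex p).1))
    exact Nat.add_le_add_left (Finset.sum_le_sum fun x _ => Nat.le_sub_one_of_lt (Fin.is_lt _)) _
  · exact Finset.le_sup (f := fun p : Σₗ i, Lex ((x : F i) → Fin (α x)) =>
        ∑ v ∈ A (ofLex p).1, α v + ∑ x, (ofLex (ofLex p).2 x : ℕ))
      (Finset.mem_univ (toLex ⟨i, toLex fun x => ⟨α x - 1, Nat.sub_lt (hα x) one_pos⟩⟩))

theorem pd_facetIdeal_expansion {K : Type*} [Field K] [Finite V] [Nonempty ι] {Δ : FaceComplex V}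
    (hF : Set.range F = Δ.facets) (hα : ∀ v, 0 < α v) :
    pd ((Δ.expansion α).facetIdeal K) =
      (Finset.univ.sup fun i => ∑ v ∈ A i, α v + ∑ v ∈ F i, (α v - 1) : ℕ) := by
  have : Nonempty (Σₗ i, Lex ((x : F i) → Fin (α x))) :=
    ‹Nonempty ι›.map fun i => toLex ⟨i, toLex fun x => ⟨0, hα x⟩⟩
  rw [← h.sup_card_expansionColon hα, ← (h.expansion α).pd_squarefreeIdeal (K := K),
    facetIdeal_eq_squarefreeIdeal]
  congr 2
  ext G
  rw [mem_facets_expansion hα, ← hF, Set.exists_range_iff]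
  exact ⟨fun ⟨i, j, hj⟩ => ⟨toLex ⟨i, toLex j⟩, hj⟩,
    fun ⟨p, hp⟩ => ⟨(ofLex p).1, ofLex (ofLex p).2, hp⟩⟩

end IsLinearQuotientFamily

namespace FaceComplex

variable {V : Type*} [Finite V] (Δ : FaceComplex V)

theorem exists_facet_of_mem_faces {G : Finset V} (hG : G ∈ Δ.faces) : ∃ F ∈ Δ.facets, G ⊆ F := by
  obtain ⟨F, hle, hF⟩ := (Set.toFinite Δ.faces).exists_le_maximal hG
  exact ⟨F, hF, hle⟩

theorem nonempty_facets : Δ.facets.Nonempty :=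
  let ⟨F, hF, _⟩ := Δ.exists_facet_of_mem_faces Δ.empty_mem
  ⟨F, hF⟩

variable {Δ}

theorem card_le_dim_add_one {F : Finset V} (hF : F ∈ Δ.faces) : (#F : ℤ) ≤ Δ.dim + 1 := by
  rw [dim, sub_add_cancel, Nat.cast_le]
  exact le_csSup (Set.toFinite _).bddAbove ⟨F, hF, rfl⟩

theorem IsPure.card_eq (h : Δ.IsPure) {F : Finset V} (hF : F ∈ Δ.facets) :
    (#F : ℤ) = Δ.dim + 1 := by
  refine le_antisymm (card_le_dim_add_one hF.prop) ?_
  obtain ⟨G, hG, hGcard⟩ := Nat.sSup_mem (s := Finset.card '' Δ.faces)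
    ⟨_, ∅, Δ.empty_mem, rfl⟩ (Set.toFinite _).bddAbove
  obtain ⟨F', hF', hle⟩ := Δ.exists_facet_of_mem_faces hG
  rw [dim, sub_add_cancel, Nat.cast_le, ← hGcard, h F hF F' hF']
  exact Finset.card_le_card hle

end FaceComplex

theorem proposition2p8 {V K : Type*} [Finite V] [Field K] (Δ : FaceComplex V)
    (hΔ : MonomialIdeal.HasLinearQuotients (Δ.facetIdeal K)) (s : ℕ) (hs : 1 ≤ s) :
    ∃ p q : ℕ,
      MonomialIdeal.pd (Δ.facetIdeal K) = p ∧
      MonomialIdeal.pd ((Δ.expansion fun _ => s).facetIdeal K) = q ∧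
      (q : ℤ) ≤ s * p + (Δ.dim + 1) * (s - 1) ∧
      (Δ.IsPure → (q : ℤ) = s * p + (Δ.dim + 1) * (s - 1)) := by
  obtain ⟨n, ⟨e⟩⟩ := Finite.exists_equiv_fin V
  let : LinearOrder V := LinearOrder.lift' e e.injective
  obtain ⟨m, F, A, hFA, hF⟩ := Δ.exists_isLinearQuotientFamily hΔ
  have hfacet (i) : F i ∈ Δ.facets := hF ▸ Set.mem_range_self i
  have : Nonempty (Fin m) := Set.range_nonempty_iff_nonempty.1 (hF ▸ Δ.nonempty_facets)
  have hp : MonomialIdeal.pd (Δ.facetIdeal K) = (Finset.univ.sup fun i => #(A i) : ℕ) := by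
    rw [FaceComplex.facetIdeal_eq_squarefreeIdeal, ← hF, hFA.pd_squarefreeIdeal]
  have hq : MonomialIdeal.pd ((Δ.expansion fun _ => s).facetIdeal K) =
      (Finset.univ.sup fun i => s * #(A i) + #(F i) * (s - 1) : ℕ) := by
    simpa [mul_comm s] using hFA.pd_facetIdeal_expansion (K := K) hF fun _ => hs
  obtain ⟨D, hD⟩ : ∃ D : ℕ, Δ.dim + 1 = D := ⟨_, sub_add_cancel _ _⟩
  rw [hD, ← Nat.cast_pred hs]
  have hsup : (Finset.univ.sup fun i => s * #(A i) + D * (s - 1)) =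
      s * (Finset.univ.sup fun i => #(A i)) + D * (s - 1) := by
    rw [Finset.mul_sup₀, Finset.sup_add Finset.univ_nonempty]
  refine ⟨_, _, hp, hq, mod_cast hsup ▸ Finset.sup_mono_fun fun i _ => ?_, fun hpure => ?_⟩
  · gcongr
    exact_mod_cast hD ▸ FaceComplex.card_le_dim_add_one (hfacet i).prop
  · have hcard (i) : #(F i) = D := Nat.cast_injective (hD ▸ hpure.card_eq (hfacet i))
    exact_mod_cast by simp only [hcard, hsup]
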